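/- Let $f$ be a polynomial in one complex variable of degree at least $2$, and write $f^n$ for its $n$-th iterate ($f^0=\mathrm{id}$). The Fatou set of $f$ is the set of points $z\in\mathbb{C}$ that have an open neighbourhood $U$ on which the iterates of $f$ form a normal family, i.e. every sequence of iterates has a subsequence that converges locally uniformly on $U$ either to a finite function or to $\infty$. The Julia set $J(f)\subset\mathbb{C}$ is the complement of the Fatou set. One says that $f$ has a time average near $z\in\mathbb{C}$ if there exist a neighbourhood $U$ of $z$, a constant $c\in\mathbb{C}$ and a sequence $a_0,a_1,\ldots$ of complex numbers, not all zero, such that the maps $\sum_{n=0}^{N}a_nf^n$ converge uniformly on $U$ to the constant function $c$ as $N\to\infty$. If $z\in J(f)$, then $f$ does not have a time average near $z$. -/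

import Mathlib

open Filter Topology

/-- A map `f : ℂ → ℂ` has a (weighted) time average near `z`: there are a neighbourhood `U` of `z`,
a constant `c` and a sequence `a 0, a 1, …` of complex weights, not all zero, such that the maps
`∑ n ≤ N, a n • f^n` converge uniformly on `U` to the constant `c` as `N → ∞`. -/
def HasTimeAverageNear (f : ℂ → ℂ) (z : ℂ) : Prop :=
  ∃ U ∈ 𝓝 z, ∃ c : ℂ, ∃ a : ℕ → ℂ, (∃ n, a n ≠ 0) ∧
    TendstoUniformlyOn (fun (N : ℕ) (w : ℂ) => ∑ n ∈ Finset.range (N + 1), a n * f^[n] w)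
      (fun _ => c) atTop U

/-- The sequence `F` tends to infinity, uniformly on compact subsets of `U`. -/
def TendstoInftyLocallyUniformlyOn (F : ℕ → ℂ → ℂ) (U : Set ℂ) : Prop :=
  ∀ K ⊆ U, IsCompact K → ∀ R : ℝ, ∀ᶠ k in atTop, ∀ w ∈ K, R < ‖F k w‖

/-- The family `F` of maps is normal on `U`: every sequence of members of the family has a
subsequence that converges locally uniformly on `U`, either to a finite limit function or to
infinity. -/
def IsNormalFamilyOn {ι : Type*} (F : ι → ℂ → ℂ) (U : Set ℂ) : Prop :=
  ∀ s : ℕ → ι, ∃ φ : ℕ → ℕ, StrictMono φ ∧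
    ((∃ g : ℂ → ℂ, TendstoLocallyUniformlyOn (fun k => F (s (φ k))) g atTop U) ∨
      TendstoInftyLocallyUniformlyOn (fun k => F (s (φ k))) U)

/-- The Fatou set of `f` (in the plane): the points with an open neighbourhood on which the
iterates of `f` form a normal family. -/
def fatouSet (f : ℂ → ℂ) : Set ℂ :=
  {z | ∃ U : Set ℂ, IsOpen U ∧ z ∈ U ∧ IsNormalFamilyOn (fun n : ℕ => f^[n]) U}

/-- The Julia set of `f` (in the plane): the complement of the Fatou set. -/
def juliaSet (f : ℂ → ℂ) : Set ℂ := (fatouSet f)ᶜ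

/-! Let `d` be the degree, `G` the Green function and `S_N` the partial sums. Since `G ∘ f = d G`
and `G - log⁺|w|` is bounded, `|f^n|` has size `exp(d^n G)` wherever `G > 0`, so convergence of the
series is governed by the rates `t` with `a_n = O(exp(-d^n t))`. A Julia point `z` has `G z = 0`
(near points with `G > 0` the iterates tend to infinity) and is a limit of points with `G > 0`
(otherwise the iterates are bounded near `z`, and Montel applies). Convergence at such an escaping
point yields a positive rate. Let `e` be the supremum of all rates.

If `e` is finite, the series is holomorphic on `{G < e}` and equals `c` on the component `V` of `z`.
The boundary of `V` has a point `p` near which `G` is the real part of a holomorphic `L` with `L' p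
≠ 0`, so near `p` the whole of `{G < e}` lies in `V`. There `S_N - c` is minus a tail whose first
index is `N + 1`. As `d ≥ 2`, this tail is far smaller than `exp(d^N (G - e))`, the order of growth
of `S_N` beyond the level line. A two constants argument for `(S_N - c) exp(-d^N (L - e))` then
makes `S_N p - c` decay doubly exponentially (`exists_norm_iterateSum_sub_le`), which gives a rate
above `e` (`exists_gt_mem_doubleExpRates`), a contradiction.

If `e` is infinite, the series is entire and constant. A critical point of `f` forces `a_0 = 0`, and
surjectivity of `f` lets the argument be repeated for the shifted weights
(`eq_zero_of_iterateSeries_const`). -/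

/-! ### Behaviour of a polynomial near infinity. -/

open Real in
/-- The defect of the functional equation `log⁺ |f w| = deg f * log⁺ |w|`. -/
noncomputable def greenDefect (f : Polynomial ℂ) (w : ℂ) : ℝ :=
  log⁺ ‖f.eval w‖ - f.natDegree * log⁺ ‖w‖

open Real in
/-- The Green function (escape rate) of a polynomial. -/
noncomputable def greenFun (f : Polynomial ℂ) (w : ℂ) : ℝ :=
  log⁺ ‖w‖ + ∑' j : ℕ, greenDefect f ((fun w => f.eval w)^[j] w) / (f.natDegree : ℝ) ^ (j + 1)

theorem Polynomial.eval_eq_reverse_eval_inv_mul_pow (f : Polynomial ℂ) {v : ℂ} (hv : v ≠ 0) :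
    f.eval v = f.reverse.eval v⁻¹ * v ^ f.natDegree := by
  let := invertibleOfNonzero hv
  have := Polynomial.eval₂_reverse_mul_pow (RingHom.id ℂ) v f
  rw [invOf_eq_inv] at this
  exact this.symm

/-- In the variable `1/v` the quotient is a polynomial with value `1` at `0`. The bound `1/2` keeps
it where the principal logarithm is holomorphic and bounded. -/
theorem Polynomial.exists_norm_eval_div_sub_one_lt (f : Polynomial ℂ) (hf : f ≠ 0) :
    ∃ R : ℝ, 1 ≤ R ∧ ∀ v : ℂ, R ≤ ‖v‖ →
      ‖f.eval v / (f.leadingCoeff * v ^ f.natDegree) - 1‖ < 1 / 2 := by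
  have hl : f.leadingCoeff ≠ 0 := by simpa using hf
  have hc : ContinuousAt (fun u : ℂ => f.reverse.eval u / f.leadingCoeff) 0 := by
    apply Continuous.continuousAt
    fun_prop
  have h0 : f.reverse.eval 0 / f.leadingCoeff = 1 := by
    rw [← Polynomial.coeff_zero_eq_eval_zero, Polynomial.coeff_zero_reverse, div_self hl]
  obtain ⟨δ, hδ, h⟩ := Metric.continuousAt_iff.1 hc (1 / 2) (by norm_num)
  refine ⟨1 + δ⁻¹, by linarith [inv_pos.2 hδ], fun v hv => ?_⟩
  have hvp : 0 < ‖v‖ := by linarith [inv_pos.2 hδ]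
  have hv0 : v ≠ 0 := norm_pos_iff.1 hvp
  have := @h v⁻¹ (by
    rw [dist_zero_right, norm_inv]
    exact inv_lt_of_inv_lt₀ hδ (by linarith))
  rw [h0, dist_eq_norm] at this
  rwa [f.eval_eq_reverse_eval_inv_mul_pow hv0, mul_div_mul_right _ _ (pow_ne_zero f.natDegree hv0)]

open Real in
theorem exists_abs_greenDefect_le (f : Polynomial ℂ) (hf : f ≠ 0) :
    ∃ C : ℝ, 0 ≤ C ∧ ∀ w, |greenDefect f w| ≤ C := by
  obtain ⟨R, hR1, hR⟩ := f.exists_norm_eval_div_sub_one_lt hf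
  have hl : 0 < ‖f.leadingCoeff‖ := by simpa using hf
  set d := f.natDegree
  have hcont : Continuous (greenDefect f) := by
    unfold greenDefect
    fun_prop
  obtain ⟨C₁, hC₁⟩ := (isCompact_closedBall (0 : ℂ) R).exists_bound_of_continuousOn
    hcont.continuousOn
  have key : ∀ w : ℂ, R ≤ ‖w‖ → |greenDefect f w| ≤ log 2 + |log ‖f.leadingCoeff‖| := by
    intro w hw
    have hw0 : 0 < ‖w‖ := by linarith
    set q := f.eval w / (f.leadingCoeff * w ^ d) with hq
    have hqn : ‖q - 1‖ < 1 / 2 := hR w hw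
    have hq1 : 1 / 2 ≤ ‖q‖ := by
      have := norm_sub_norm_le (1 : ℂ) (1 - q)
      rw [sub_sub_cancel, norm_one, norm_sub_rev] at this
      linarith
    have hq2 : ‖q‖ ≤ 2 := by
      have := norm_add_le (q - 1) 1
      rw [sub_add_cancel, norm_one] at this
      linarith
    have he : f.eval w = q * (f.leadingCoeff * w ^ d) := by
      rw [hq, div_mul_cancel₀]
      exact mul_ne_zero (norm_pos_iff.1 hl) (pow_ne_zero _ (norm_pos_iff.1 hw0))
    have hlogq : |log ‖q‖| ≤ log 2 := by
      rw [abs_le]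
      constructor
      · rw [← log_inv]
        apply log_le_log (by norm_num)
        linarith
      · exact log_le_log (by linarith) hq2
    have hle : log ‖f.eval w‖ = log ‖q‖ + (log ‖f.leadingCoeff‖ + d * log ‖w‖) := by
      rw [he, norm_mul, norm_mul, norm_pow, log_mul, log_mul, log_pow]
      all_goals positivity
    have hlw : log⁺ ‖w‖ = log ‖w‖ := posLog_eq_log (by rw [abs_norm]; linarith)
    have hlw0 : 0 ≤ log ‖w‖ := log_nonneg (by linarith)
    have hd0 : 0 ≤ d * log ‖w‖ := by positivity
    have h1 := abs_le.1 hlogq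
    have h2 := abs_le.1 (le_refl |log ‖f.leadingCoeff‖|)
    have h3 := abs_nonneg (log ‖f.leadingCoeff‖)
    unfold greenDefect
    rw [hlw, posLog_apply, hle, abs_le]
    constructor
    · have := le_max_right 0 (log ‖q‖ + (log ‖f.leadingCoeff‖ + d * log ‖w‖))
      linarith
    · rw [sub_le_iff_le_add]
      apply max_le <;> linarith [log_nonneg (show (1:ℝ) ≤ 2 by norm_num)]
  refine ⟨max C₁ (log 2 + |log ‖f.leadingCoeff‖|), (abs_nonneg _).trans ((hC₁ 0 (by simp; linarith)).trans (le_max_left _ _)),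
    fun w => ?_⟩
  rcases le_total ‖w‖ R with h | h
  · exact (hC₁ w (by simpa using h)).trans (le_max_left _ _)
  · exact (key w h).trans (le_max_right _ _)

theorem Polynomial.continuous_iterate_eval (f : Polynomial ℂ) (n : ℕ) :
    Continuous ((fun w => f.eval w)^[n]) :=
  f.continuous.iterate n

theorem Polynomial.differentiable_iterate_eval (f : Polynomial ℂ) (n : ℕ) :
    Differentiable ℂ ((fun w => f.eval w)^[n]) :=
  Differentiable.iterate f.differentiable n

/-! ### Functional equation of the Green function and growth of iterates. -/

section Green

variable {f : Polynomial ℂ} (hf : 2 ≤ f.natDegree)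
include hf

theorem Polynomial.ne_zero_of_two_le_natDegree : f ≠ 0 := by
  rintro rfl
  simp at hf

theorem summable_div_natDegree_pow (C : ℝ) :
    Summable fun j : ℕ => C / (f.natDegree : ℝ) ^ (j + 1) := by
  have h2 : (2 : ℝ) ≤ f.natDegree := by exact_mod_cast hf
  have := (summable_geometric_of_lt_one (r := (f.natDegree : ℝ)⁻¹) (by positivity)
    (inv_lt_one_of_one_lt₀ (by linarith))).mul_left (C / f.natDegree)
  refine this.congr fun j => ?_
  rw [pow_succ, inv_pow]
  field_simp

theorem summable_greenDefect (w : ℂ) : Summable fun j : ℕ =>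
    greenDefect f ((fun w => f.eval w)^[j] w) / (f.natDegree : ℝ) ^ (j + 1) := by
  obtain ⟨C, hC0, hC⟩ := exists_abs_greenDefect_le f (Polynomial.ne_zero_of_two_le_natDegree hf)
  refine Summable.of_norm_bounded (summable_div_natDegree_pow hf C) fun j => ?_
  rw [norm_div, Real.norm_eq_abs, norm_pow, Real.norm_natCast]
  gcongr
  exact hC _

theorem continuous_greenFun : Continuous (greenFun f) := by
  obtain ⟨C, hC0, hC⟩ := exists_abs_greenDefect_le f (Polynomial.ne_zero_of_two_le_natDegree hf)
  unfold greenFun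
  refine Continuous.add (by fun_prop) (continuous_tsum (fun j => ?_)
    (summable_div_natDegree_pow hf C) fun j w => ?_)
  · have := f.continuous_iterate_eval j
    unfold greenDefect
    fun_prop
  · rw [norm_div, Real.norm_eq_abs, norm_pow, Real.norm_natCast]
    gcongr
    exact hC _

open Real in
theorem greenFun_eval (w : ℂ) : greenFun f (f.eval w) = f.natDegree * greenFun f w := by
  have hd : (f.natDegree : ℝ) ≠ 0 := by positivity
  unfold greenFun
  rw [(summable_greenDefect hf w).tsum_eq_zero_add, mul_add, mul_add, ← tsum_mul_left]
  simp only [Function.iterate_succ_apply, Function.iterate_zero, id]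
  have : f.natDegree * (greenDefect f w / (f.natDegree : ℝ) ^ (0 + 1)) = greenDefect f w := by
    rw [zero_add, pow_one, mul_div_cancel₀ _ hd]
  rw [this, greenDefect, ← add_assoc, add_sub_cancel]
  congr 1
  refine tsum_congr fun j => ?_
  rw [pow_succ _ (j + 1)]
  field_simp

theorem greenFun_iterate (n : ℕ) (w : ℂ) :
    greenFun f ((fun w => f.eval w)^[n] w) = (f.natDegree : ℝ) ^ n * greenFun f w := by
  induction n with
  | zero => simp
  | succ n ih => rw [Function.iterate_succ_apply', greenFun_eval hf, ih, pow_succ]; ring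

open Real in
theorem exists_abs_greenFun_sub_posLog_le :
    ∃ C : ℝ, 0 ≤ C ∧ ∀ w, |greenFun f w - log⁺ ‖w‖| ≤ C := by
  obtain ⟨C, hC0, hC⟩ := exists_abs_greenDefect_le f (Polynomial.ne_zero_of_two_le_natDegree hf)
  refine ⟨∑' j : ℕ, C / (f.natDegree : ℝ) ^ (j + 1), tsum_nonneg fun j => by positivity,
    fun w => ?_⟩
  rw [greenFun, add_sub_cancel_left, ← Real.norm_eq_abs]
  refine tsum_of_norm_bounded (summable_div_natDegree_pow hf C).hasSum fun j => ?_
  rw [norm_div, Real.norm_eq_abs, norm_pow, Real.norm_natCast]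
  gcongr
  exact hC _

open Real in
/-- Two-sided growth estimate for the iterates in terms of the Green function. -/
theorem exists_iterate_bounds : ∃ C : ℝ, 1 ≤ C ∧ ∀ (n : ℕ) (w : ℂ),
    ‖(fun w => f.eval w)^[n] w‖ ≤ C * exp ((f.natDegree : ℝ) ^ n * greenFun f w) ∧
    exp ((f.natDegree : ℝ) ^ n * greenFun f w) ≤ C * max 1 ‖(fun w => f.eval w)^[n] w‖ := by
  obtain ⟨C, hC0, hC⟩ := exists_abs_greenFun_sub_posLog_le hf
  refine ⟨exp C, one_le_exp hC0, fun n w => ?_⟩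
  set v := (fun w => f.eval w)^[n] w
  have h := abs_le.1 (hC v)
  rw [greenFun_iterate hf] at h
  have hm : exp (log⁺ ‖v‖) = max 1 ‖v‖ := by
    rw [posLog_eq_log_max_one (norm_nonneg _), exp_log (by positivity)]
  constructor
  · refine (le_max_right 1 _).trans ?_
    rw [← hm, ← exp_add]
    exact exp_le_exp.2 (by linarith)
  · rw [← hm, ← exp_add]
    exact exp_le_exp.2 (by linarith)

theorem greenFun_nonneg (w : ℂ) : 0 ≤ greenFun f w := by
  obtain ⟨C, hC1, hC⟩ := exists_iterate_bounds hf
  by_contra! h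
  have h2 : (1 : ℝ) < f.natDegree := by exact_mod_cast hf
  have ht : Tendsto (fun n : ℕ => (f.natDegree : ℝ) ^ n * greenFun f w) atTop atBot :=
    (tendsto_pow_atTop_atTop_of_one_lt h2).atTop_mul_const_of_neg h
  obtain ⟨C', hC'0, hC'⟩ := exists_abs_greenFun_sub_posLog_le hf
  obtain ⟨n, hn⟩ := (ht.eventually (eventually_lt_atBot (-C'))).exists
  have := abs_le.1 (hC' ((fun w => f.eval w)^[n] w))
  rw [greenFun_iterate hf] at this
  have := Real.posLog_nonneg (x := ‖(fun w => f.eval w)^[n] w‖)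
  linarith

end Green

/-! ### The Green function at and near Julia points. -/

section Julia

variable {f : Polynomial ℂ} (hf : 2 ≤ f.natDegree)
include hf

theorem isNormalFamilyOn_of_le_greenFun {η : ℝ} (hη : 0 < η) :
    IsNormalFamilyOn (fun n : ℕ => (fun w => f.eval w)^[n]) {w | η < greenFun f w} := by
  intro s
  -- Either some iterate recurs infinitely often, giving a constant subsequence, or the exponents
  -- tend to infinity and so do the iterates, uniformly.
  by_cases hs : ∃ n, ∃ᶠ k in atTop, s k = n
  · obtain ⟨n, hn⟩ := hs
    obtain ⟨φ, hφ, h⟩ := extraction_of_frequently_atTop hn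
    refine ⟨φ, hφ, Or.inl ⟨(fun w => f.eval w)^[n], ?_⟩⟩
    simp only [h]
    refine TendstoUniformlyOn.tendstoLocallyUniformlyOn ?_
    rw [Metric.tendstoUniformlyOn_iff]
    intro ε hε
    filter_upwards with k x hx
    simpa using hε
  · refine ⟨id, strictMono_id, Or.inr ?_⟩
    simp only [not_exists, not_frequently] at hs
    have hs' : Tendsto s atTop atTop := by
      refine tendsto_atTop.2 fun b => ?_
      filter_upwards [(Finset.range b).eventually_all.2 fun n _ => hs n] with k hk
      by_contra! h
      exact hk (s k) (Finset.mem_range.2 h) rfl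
    obtain ⟨C, hC1, hC⟩ := exists_iterate_bounds hf
    have h2 : (1 : ℝ) < f.natDegree := by exact_mod_cast hf
    have ht : Tendsto (fun n : ℕ => Real.exp ((f.natDegree : ℝ) ^ n * η)) atTop atTop :=
      Real.tendsto_exp_atTop.comp
        ((tendsto_pow_atTop_atTop_of_one_lt h2).atTop_mul_const hη)
    intro K hK _ R
    filter_upwards [(ht.comp hs').eventually_gt_atTop (C * max 1 R)] with k hk w hw
    have h1 := (hC (s k) w).2
    have h3 : Real.exp ((f.natDegree : ℝ) ^ (s k) * η)
        ≤ Real.exp ((f.natDegree : ℝ) ^ (s k) * greenFun f w) := by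
      have := (show η < greenFun f w from hK hw).le
      gcongr
    have h4 : max 1 R < max 1 ‖(fun w => f.eval w)^[s k] w‖ :=
      lt_of_mul_lt_mul_left (hk.trans_le (h3.trans h1)) (by linarith)
    rcases lt_max_iff.1 h4 with h | h
    · exact absurd ((le_max_left 1 R).trans_lt h) (lt_irrefl 1)
    · exact (le_max_right 1 R).trans_lt h

omit hf in
/-- Montel's theorem for a sequence of uniformly bounded entire functions. -/
theorem isNormalFamilyOn_of_norm_le {F : ℕ → ℂ → ℂ} (hF : ∀ n, Differentiable ℂ (F n)) {z : ℂ}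
    {r C : ℝ} (hr : 0 < r) (hC : ∀ n, ∀ w ∈ Metric.closedBall z (2 * r), ‖F n w‖ ≤ C) :
    IsNormalFamilyOn F (Metric.ball z r) := by
  intro s
  set K := Metric.closedBall z r
  have hKc : CompactSpace K := isCompact_iff_compactSpace.1 (isCompact_closedBall z r)
  have hC0 : 0 ≤ C := (norm_nonneg _).trans (hC 0 z (Metric.mem_closedBall_self (by linarith)))
  -- Cauchy's estimate on circles of radius `r` centred in `K`, which stay in the ball of radius `2
  -- * r`. It provides the equicontinuity for Arzelà–Ascoli.
  have hd : ∀ n, ∀ w ∈ K, ‖deriv (F n) w‖ ≤ C / r := by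
    intro n w hw
    refine Complex.norm_deriv_le_of_forall_mem_sphere_norm_le hr (hF n).diffContOnCl fun x hx => ?_
    refine hC n x ?_
    have h1 : dist x w = r := hx
    have h2 : dist w z ≤ r := hw
    exact (dist_triangle x w z).trans (by linarith)
  have hL : ∀ n, ∀ x ∈ K, ∀ y ∈ K, ‖F n y - F n x‖ ≤ C / r * ‖y - x‖ := fun n x hx y hy =>
    (convex_closedBall z r).norm_image_sub_le_of_norm_deriv_le
      (fun w _ => (hF n).differentiableAt) (hd n) hx hy
  let G : ℕ → BoundedContinuousFunction K ℂ := fun n =>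
    BoundedContinuousFunction.mkOfCompact ⟨K.domRestrict (F n), (hF n).continuous.continuousOn.domRestrict⟩
  have hG : ∀ n (x : K), G n x = F n x := fun n x => rfl
  have hcomp : IsCompact (closure (Set.range G)) := by
    refine BoundedContinuousFunction.arzela_ascoli (Metric.closedBall 0 C)
      (isCompact_closedBall 0 C) _ ?_ ?_
    · rintro _ x ⟨n, rfl⟩
      rw [hG, mem_closedBall_zero_iff]
      exact hC n x (Metric.closedBall_subset_closedBall (by linarith) x.2)
    · refine Metric.equicontinuous_of_continuity_modulus (fun t => C / r * t) ?_ _ ?_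
      · have : Tendsto (fun t : ℝ => C / r * t) (𝓝 0) (𝓝 (C / r * 0)) :=
          (continuous_const.mul continuous_id).tendsto 0
        simpa using this
      · rintro x y ⟨_, n, rfl⟩
        have := hL n y y.2 x x.2
        rw [← dist_eq_norm, ← dist_eq_norm] at this
        exact this
  obtain ⟨g, -, φ, hφ, hg⟩ := hcomp.tendsto_subseq (x := fun k => G (s k))
    fun k => subset_closure ⟨s k, rfl⟩
  refine ⟨φ, hφ, Or.inl ⟨Function.extend Subtype.val g 0, ?_⟩⟩
  refine (TendstoUniformlyOn.mono ?_ Metric.ball_subset_closedBall).tendstoLocallyUniformlyOn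
  rw [BoundedContinuousFunction.tendsto_iff_tendstoUniformly, Metric.tendstoUniformly_iff] at hg
  rw [Metric.tendstoUniformlyOn_iff]
  intro ε hε
  filter_upwards [hg ε hε] with k hk x hx
  have := hk ⟨x, hx⟩
  rw [show x = Subtype.val (⟨x, hx⟩ : K) from rfl, Subtype.val_injective.extend_apply]
  exact this

theorem greenFun_eq_zero_of_mem_juliaSet {z : ℂ} (hz : z ∈ juliaSet (fun w => f.eval w)) :
    greenFun f z = 0 := by
  by_contra h
  have hpos := (greenFun_nonneg hf z).lt_of_ne' h
  exact hz ⟨{w | greenFun f z / 2 < greenFun f w},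
    isOpen_lt continuous_const (continuous_greenFun hf), half_lt_self hpos,
    isNormalFamilyOn_of_le_greenFun hf (half_pos hpos)⟩

/-- Where `G` vanishes, all iterates are bounded by one constant, so vanishing near `z` would put
`z` in the Fatou set by Montel. -/
theorem exists_greenFun_pos_of_mem_juliaSet {z : ℂ} (hz : z ∈ juliaSet (fun w => f.eval w))
    {U : Set ℂ} (hU : U ∈ 𝓝 z) : ∃ x ∈ U, 0 < greenFun f x := by
  by_contra! h
  obtain ⟨r, hr, hrU⟩ := Metric.nhds_basis_closedBall.mem_iff.1 hU
  obtain ⟨C, hC1, hC⟩ := exists_iterate_bounds hf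
  refine hz ⟨Metric.ball z (r / 2), Metric.isOpen_ball, Metric.mem_ball_self (half_pos hr),
    isNormalFamilyOn_of_norm_le (C := C) f.differentiable_iterate_eval (half_pos hr)
      fun n w hw => ?_⟩
  have h0 : greenFun f w = 0 :=
    le_antisymm (h w (hrU (by rwa [mul_div_cancel₀ _ two_ne_zero] at hw))) (greenFun_nonneg hf w)
  simpa [h0] using (hC n w).1

end Julia

/-! ### The Green function as the real part of a holomorphic function. -/

section Potential

variable {f : Polynomial ℂ} (hf : 2 ≤ f.natDegree)
include hf

/-- Near infinity, the Green function is locally the real part of a holomorphic function. -/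
theorem exists_re_eq_greenFun_of_le_norm {R : ℝ} (hR1 : 1 ≤ R)
    (hR : ∀ v : ℂ, R ≤ ‖v‖ → ‖f.eval v / (f.leadingCoeff * v ^ f.natDegree) - 1‖ < 1 / 2)
    {W : Set ℂ} (hWo : IsOpen W) {v₀ : ℂ} (hv₀ : v₀ ≠ 0)
    (hW : ∀ v ∈ W, v / v₀ ∈ Complex.slitPlane)
    (hWR : ∀ v ∈ W, ∀ n, R ≤ ‖(fun w => f.eval w)^[n] v‖) :
    ∃ L : ℂ → ℂ, DifferentiableOn ℂ L W ∧ ∀ v ∈ W, (L v).re = greenFun f v := by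
  have hl : f.leadingCoeff ≠ 0 := by
    simpa using Polynomial.ne_zero_of_two_le_natDegree hf
  set q : ℂ → ℂ := fun v => f.eval v / (f.leadingCoeff * v ^ f.natDegree) with hq
  set t : ℕ → ℂ → ℂ := fun j v => ((f.natDegree : ℝ) ^ (j + 1))⁻¹ •
    (Complex.log (q ((fun w => f.eval w)^[j] v)) + Complex.log f.leadingCoeff) with ht
  have hne : ∀ v : ℂ, R ≤ ‖v‖ → v ≠ 0 := fun v hv => norm_pos_iff.1 (by linarith)
  have hqs : ∀ v : ℂ, R ≤ ‖v‖ → q v ∈ Complex.slitPlane := by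
    intro v hv
    have := Complex.mem_slitPlane_of_norm_lt_one (z := q v - 1) ((hR v hv).trans (by norm_num))
    rwa [add_sub_cancel] at this
  have hqn : ∀ v : ℂ, R ≤ ‖v‖ → ‖Complex.log (q v)‖ ≤ 1 := by
    intro v hv
    have := Complex.norm_log_one_add_half_le_self (hR v hv).le
    rw [add_sub_cancel] at this
    linarith [hR v hv]
  have htb : ∀ j, ∀ v ∈ W,
      ‖t j v‖ ≤ (1 + ‖Complex.log f.leadingCoeff‖) / (f.natDegree : ℝ) ^ (j + 1) := by
    intro j v hv
    rw [ht, norm_smul, norm_inv, norm_pow, Real.norm_natCast, inv_mul_eq_div]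
    gcongr
    exact (norm_add_le _ _).trans (add_le_add_left (hqn _ (hWR v hv j)) _)
  have hsum := summable_div_natDegree_pow hf (1 + ‖Complex.log f.leadingCoeff‖)
  -- The first two terms form a branch of `log v` on `W`. Along orbits outside radius `R` no `log⁺`
  -- is truncated, so the defect at `u` is exactly `log|q u| + log|leadingCoeff|`, and `t j` is its
  -- holomorphic completion.
  refine ⟨fun v => Complex.log v₀ + Complex.log (v / v₀) + ∑' j, t j v, ?_, ?_⟩
  · refine DifferentiableOn.add ?_ ?_
    · refine DifferentiableOn.add (differentiableOn_const _) ?_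
      exact DifferentiableOn.clog (differentiableOn_id.div_const _) hW
    · refine Complex.differentiableOn_tsum_of_summable_norm hsum (fun j => ?_) hWo htb
      refine DifferentiableOn.fun_const_smul (DifferentiableOn.add_const (Complex.log f.leadingCoeff) ?_) _
      refine DifferentiableOn.clog ?_ fun v hv => hqs _ (hWR v hv j)
      have hd := (f.differentiable_iterate_eval j).differentiableOn (s := W)
      refine DifferentiableOn.div (f.differentiable.comp_differentiableOn hd)
        ((differentiableOn_const _).mul (hd.pow _)) fun v hv => ?_
      exact mul_ne_zero hl (pow_ne_zero _ (hne _ (hWR v hv j)))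
  · intro v hv
    have hvR : R ≤ ‖v‖ := hWR v hv 0
    have hs : Summable fun j => t j v := Summable.of_norm_bounded hsum fun j => htb j v hv
    have hv0 : ‖v₀‖ ≠ 0 := norm_ne_zero_iff.2 hv₀
    have hvn : ‖v‖ ≠ 0 := norm_ne_zero_iff.2 (hne v hvR)
    rw [Complex.add_re, Complex.add_re, Complex.log_re, Complex.log_re, norm_div,
      Real.log_div hvn hv0, Complex.re_tsum hs, greenFun,
      Real.posLog_eq_log (by rw [abs_norm]; linarith), add_sub_cancel]
    congr 1
    refine tsum_congr fun j => ?_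
    have h1 := hWR v hv j
    have h2 := hWR v hv (j + 1)
    rw [Function.iterate_succ_apply'] at h2
    set u := (fun w => f.eval w)^[j] v
    have hu : ‖u‖ ≠ 0 := norm_ne_zero_iff.2 (hne u h1)
    have hfu : ‖f.eval u‖ ≠ 0 := norm_ne_zero_iff.2 (hne _ h2)
    have hln : ‖f.leadingCoeff‖ ≠ 0 := norm_ne_zero_iff.2 hl
    rw [ht, Complex.smul_re, smul_eq_mul, inv_mul_eq_div, Complex.add_re, Complex.log_re,
      Complex.log_re, greenDefect, Real.posLog_eq_log (x := ‖u‖) (by rw [abs_norm]; exact hR1.trans h1),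
      Real.posLog_eq_log (by rw [abs_norm]; exact hR1.trans h2), hq, norm_div, norm_mul, norm_pow,
      Real.log_div hfu (by positivity), Real.log_mul hln (by positivity), Real.log_pow]
    congr 1
    ring

/-- Off the filled Julia set, the Green function is locally the real part of a holomorphic
function. -/
theorem exists_re_eq_greenFun {p : ℂ} (hp : 0 < greenFun f p) :
    ∃ r > 0, ∃ L : ℂ → ℂ, DifferentiableOn ℂ L (Metric.ball p r) ∧
      ∀ w ∈ Metric.ball p r, (L w).re = greenFun f w := by
  obtain ⟨R, hR1, hR⟩ :=
    f.exists_norm_eval_div_sub_one_lt (Polynomial.ne_zero_of_two_le_natDegree hf)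
  obtain ⟨C, hC1, hC⟩ := exists_iterate_bounds hf
  have h1 : (1 : ℝ) < f.natDegree := by exact_mod_cast hf
  have hd0 : (0 : ℝ) < f.natDegree := by linarith
  set η := greenFun f p / 2 with hη
  have hη0 : 0 < η := half_pos hp
  have ht : Tendsto (fun n : ℕ => Real.exp ((f.natDegree : ℝ) ^ n * η)) atTop atTop :=
    Real.tendsto_exp_atTop.comp ((tendsto_pow_atTop_atTop_of_one_lt h1).atTop_mul_const hη0)
  -- After `M` steps the orbit of `p` lies where all further iterates stay outside radius `R`. The
  -- function found there is pulled back by `f^M` and divided by `d^M`.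
  obtain ⟨M, hM⟩ := (ht.eventually_gt_atTop (C * R)).exists
  have hlarge : ∀ v : ℂ, (f.natDegree : ℝ) ^ M * η < greenFun f v →
      ∀ n, R ≤ ‖(fun w => f.eval w)^[n] v‖ := by
    intro v hv n
    have h3 := (hC n v).2
    have h4 : (f.natDegree : ℝ) ^ M * η ≤ (f.natDegree : ℝ) ^ n * greenFun f v :=
      hv.le.trans (le_mul_of_one_le_left (greenFun_nonneg hf v) (one_le_pow₀ h1.le))
    have h5 : R < max 1 ‖(fun w => f.eval w)^[n] v‖ :=
      lt_of_mul_lt_mul_left (hM.trans_le ((Real.exp_le_exp.2 h4).trans h3)) (by linarith)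
    rcases lt_max_iff.1 h5 with h | h
    · linarith
    · exact h.le
  set v₀ := (fun w => f.eval w)^[M] p
  have hG0 : (f.natDegree : ℝ) ^ M * η < greenFun f v₀ := by
    rw [greenFun_iterate hf]
    have : η < greenFun f p := half_lt_self hp
    gcongr
  have hv₀ : v₀ ≠ 0 := norm_pos_iff.1 (by
    have := hlarge v₀ hG0 0
    simp only [Function.iterate_zero, id] at this
    linarith)
  set W : Set ℂ := {v | (f.natDegree : ℝ) ^ M * η < greenFun f v} ∩
    (fun v => v / v₀) ⁻¹' Complex.slitPlane
  have hWo : IsOpen W := (isOpen_lt continuous_const (continuous_greenFun hf)).inter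
    (Complex.isOpen_slitPlane.preimage (by fun_prop))
  obtain ⟨L, hL, hLG⟩ := exists_re_eq_greenFun_of_le_norm hf hR1 hR hWo hv₀
    (fun v hv => hv.2) (fun v hv => hlarge v hv.1)
  have hpW : p ∈ (fun w => f.eval w)^[M] ⁻¹' W := by
    refine ⟨hG0, ?_⟩
    change v₀ / v₀ ∈ Complex.slitPlane
    rw [div_self hv₀]
    exact Complex.one_mem_slitPlane
  obtain ⟨r, hr, hrW⟩ := Metric.isOpen_iff.1
    (hWo.preimage (f.continuous_iterate_eval M)) p hpW
  refine ⟨r, hr, fun w => ((f.natDegree : ℝ) ^ M)⁻¹ • L ((fun w => f.eval w)^[M] w), ?_, ?_⟩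
  · exact (hL.comp (f.differentiable_iterate_eval M).differentiableOn hrW).fun_const_smul _
  · intro w hw
    rw [Complex.smul_re, hLG _ (hrW hw), greenFun_iterate hf, smul_eq_mul,
      inv_mul_cancel_left₀ (by positivity)]

end Potential

/-! ### Decay rates of the weights and the series of iterates. -/

/-- The rates `t` for which `a n = O (exp (-d ^ n * t))`. -/
def doubleExpRates (d : ℕ) (a : ℕ → ℂ) : Set ℝ :=
  {t | ∃ C : ℝ, ∀ n, ‖a n‖ ≤ C * Real.exp (-((d : ℝ) ^ n * t))}

theorem doubleExpRates_anti {d : ℕ} {a : ℕ → ℂ} {s t : ℝ} (hst : s ≤ t)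
    (ht : t ∈ doubleExpRates d a) : s ∈ doubleExpRates d a := by
  obtain ⟨C, hC⟩ := ht
  have hC0 : 0 ≤ C := by
    by_contra! h
    exact absurd ((norm_nonneg _).trans (hC 0)) (not_le.2 (mul_neg_of_neg_of_pos h (Real.exp_pos _)))
  exact ⟨C, fun n => (hC n).trans (by gcongr)⟩

theorem mem_doubleExpRates_of_eventually {d : ℕ} {a : ℕ → ℂ} {t C : ℝ}
    (h : ∀ᶠ n in atTop, ‖a n‖ ≤ C * Real.exp (-((d : ℝ) ^ n * t))) : t ∈ doubleExpRates d a := by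
  have hO : a =O[atTop] fun n => Real.exp (-((d : ℝ) ^ n * t)) := by
    refine Asymptotics.IsBigO.of_bound C (h.mono fun n hn => ?_)
    rwa [Real.norm_eq_abs, Real.abs_exp]
  obtain ⟨C', -, hC'⟩ := Asymptotics.bound_of_isBigO_nat_atTop hO
  refine ⟨C', fun n => ?_⟩
  have := hC' (x := n) (Real.exp_pos _).ne'
  rwa [Real.norm_eq_abs, Real.abs_exp] at this

/-- The weighted sum of all iterates of `f`. -/
noncomputable def iterateSeries (f : Polynomial ℂ) (a : ℕ → ℂ) (w : ℂ) : ℂ :=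
  ∑' n, a n * (fun w => f.eval w)^[n] w

/-- The partial sums of `iterateSeries`. -/
noncomputable def iterateSum (f : Polynomial ℂ) (a : ℕ → ℂ) (N : ℕ) (w : ℂ) : ℂ :=
  ∑ n ∈ Finset.range (N + 1), a n * (fun w => f.eval w)^[n] w

/-- This crude linear growth of the exponents suffices to dominate doubly exponential tails by
geometric series. -/
theorem add_natCast_le_natPow_add {d : ℕ} (hd : 2 ≤ d) (m j : ℕ) :
    (d : ℝ) ^ m + j ≤ (d : ℝ) ^ (m + j) := by
  have h2 : (2 : ℝ) ≤ d := by exact_mod_cast hd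
  induction j with
  | zero => simp
  | succ j ih =>
    have h1 : (1 : ℝ) ≤ (d : ℝ) ^ (m + j) := one_le_pow₀ (by linarith)
    rw [← add_assoc, pow_succ]
    push_cast
    nlinarith

theorem summable_exp_neg_mul_nat {δ : ℝ} (hδ : 0 < δ) :
    Summable fun j : ℕ => Real.exp (-(j * δ)) := by
  have := summable_geometric_of_lt_one (Real.exp_nonneg (-δ)) (Real.exp_lt_one_iff.2 (by linarith))
  refine this.congr fun j => ?_
  rw [← Real.exp_nat_mul, mul_neg]

section Series

variable {f : Polynomial ℂ} (hf : 2 ≤ f.natDegree)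
include hf

theorem exists_norm_term_le {a : ℕ → ℂ} {t : ℝ} (ht : t ∈ doubleExpRates f.natDegree a) :
    ∃ C : ℝ, 0 ≤ C ∧ ∀ n w, ‖a n * (fun w => f.eval w)^[n] w‖ ≤
      C * Real.exp ((f.natDegree : ℝ) ^ n * (greenFun f w - t)) := by
  obtain ⟨C₁, hC₁⟩ := ht
  obtain ⟨C₂, hC₂, hb⟩ := exists_iterate_bounds hf
  refine ⟨|C₁| * C₂, by positivity, fun n w => ?_⟩
  rw [norm_mul]
  calc ‖a n‖ * ‖(fun w => f.eval w)^[n] w‖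
      ≤ (|C₁| * Real.exp (-((f.natDegree : ℝ) ^ n * t))) *
        (C₂ * Real.exp ((f.natDegree : ℝ) ^ n * greenFun f w)) := by
        gcongr
        · exact (hC₁ n).trans (by gcongr; exact le_abs_self _)
        · exact (hb n w).1
    _ = |C₁| * C₂ * (Real.exp (-((f.natDegree : ℝ) ^ n * t)) *
        Real.exp ((f.natDegree : ℝ) ^ n * greenFun f w)) := by ring
    _ = _ := by rw [← Real.exp_add]; congr 2; ring

theorem exp_natDegree_pow_mul_le {δ s : ℝ} (hδ : 0 < δ) (hs : s ≤ -δ) (m j : ℕ) :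
    Real.exp ((f.natDegree : ℝ) ^ (m + j) * s) ≤
      Real.exp ((f.natDegree : ℝ) ^ m * s) * Real.exp (-(j * δ)) := by
  rw [← Real.exp_add, Real.exp_le_exp]
  have h1 := add_natCast_le_natPow_add hf m j
  have h2 : (0 : ℝ) ≤ j := Nat.cast_nonneg j
  nlinarith

theorem summable_iterateSeries {a : ℕ → ℂ} {t : ℝ} (ht : t ∈ doubleExpRates f.natDegree a)
    {w : ℂ} (hw : greenFun f w < t) : Summable fun n => a n * (fun w => f.eval w)^[n] w := by
  obtain ⟨C, hC0, hC⟩ := exists_norm_term_le hf ht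
  refine Summable.of_norm_bounded
    ((summable_exp_neg_mul_nat (sub_pos.2 hw)).mul_left
      (C * Real.exp ((f.natDegree : ℝ) ^ 0 * (greenFun f w - t)))) fun n => (hC n w).trans ?_
  rw [mul_assoc]
  have := exp_natDegree_pow_mul_le hf (sub_pos.2 hw) (s := greenFun f w - t) (by linarith) 0 n
  rw [zero_add] at this
  gcongr

theorem differentiableOn_iterateSeries {a : ℕ → ℂ} {t : ℝ}
    (ht : t ∈ doubleExpRates f.natDegree a) :
    DifferentiableOn ℂ (iterateSeries f a) {w | greenFun f w < t} := by
  obtain ⟨C, hC0, hC⟩ := exists_norm_term_le hf ht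
  intro w hw
  have hw' : greenFun f w < t := hw
  set δ := (t - greenFun f w) / 2 with hδ
  have hδ0 : 0 < δ := half_pos (sub_pos.2 hw')
  have hopen : IsOpen {v | greenFun f v < t - δ} :=
    isOpen_lt (continuous_greenFun hf) continuous_const
  have hd : DifferentiableOn ℂ (iterateSeries f a) {v | greenFun f v < t - δ} := by
    refine Complex.differentiableOn_tsum_of_summable_norm
      ((summable_exp_neg_mul_nat hδ0).mul_left C) (fun n => ?_) hopen fun n v hv => ?_
    · exact ((f.differentiable_iterate_eval n).const_mul _).differentiableOn
    · refine (hC n v).trans ?_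
      have hv' : greenFun f v < t - δ := hv
      have h1 := exp_natDegree_pow_mul_le hf hδ0 (s := greenFun f v - t) (by linarith) 0 n
      have h2 : Real.exp ((f.natDegree : ℝ) ^ 0 * (greenFun f v - t)) ≤ 1 :=
        Real.exp_le_one_iff.2 (by rw [pow_zero]; linarith)
      rw [zero_add] at h1
      refine mul_le_mul_of_nonneg_left ?_ hC0
      exact h1.trans (mul_le_of_le_one_left (Real.exp_nonneg _) h2)
  exact (hd.differentiableAt (hopen.mem_nhds (by
    change greenFun f w < t - δ
    linarith))).differentiableWithinAt

/-- The tail of the series after `N` terms decays like its first term. -/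
theorem exists_norm_iterateSeries_sub_le {a : ℕ → ℂ} {t δ : ℝ}
    (ht : t ∈ doubleExpRates f.natDegree a) (hδ : 0 < δ) :
    ∃ K : ℝ, 0 ≤ K ∧ ∀ N w, greenFun f w ≤ t - δ → ‖iterateSeries f a w - iterateSum f a N w‖ ≤
      K * Real.exp ((f.natDegree : ℝ) ^ (N + 1) * (greenFun f w - t)) := by
  obtain ⟨C, hC0, hC⟩ := exists_norm_term_le hf ht
  refine ⟨C * ∑' j : ℕ, Real.exp (-(j * δ)), by positivity, fun N w hw => ?_⟩
  have hs := summable_iterateSeries hf ht (w := w) (by linarith)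
  rw [iterateSeries, iterateSum, ← hs.sum_add_tsum_nat_add (N + 1), add_sub_cancel_left]
  refine (tsum_of_norm_bounded ((summable_exp_neg_mul_nat hδ).mul_left
    (C * Real.exp ((f.natDegree : ℝ) ^ (N + 1) * (greenFun f w - t)))).hasSum fun j =>
      (hC _ w).trans ?_).trans (le_of_eq ?_)
  · rw [mul_assoc, add_comm j]
    gcongr
    exact exp_natDegree_pow_mul_le hf hδ (by linarith) _ _
  · rw [tsum_mul_left]
    ring

/-- Each of the `N + 1` terms obeys the bound for index `N`; truncation at `0` covers points with `G
< t`, where the terms are merely bounded. -/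
theorem exists_norm_iterateSum_le {a : ℕ → ℂ} {t : ℝ} (ht : t ∈ doubleExpRates f.natDegree a) :
    ∃ C : ℝ, 0 ≤ C ∧ ∀ N w, ‖iterateSum f a N w‖ ≤
      C * (N + 1) * Real.exp ((f.natDegree : ℝ) ^ N * max (greenFun f w - t) 0) := by
  obtain ⟨C, hC0, hC⟩ := exists_norm_term_le hf ht
  have h1 : (1 : ℝ) ≤ f.natDegree := by exact_mod_cast (by omega : 1 ≤ f.natDegree)
  refine ⟨C, hC0, fun N w => ?_⟩
  refine (norm_sum_le_of_le (f := fun n => a n * (fun w => f.eval w)^[n] w) _ (n := fun _ =>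
    C * Real.exp ((f.natDegree : ℝ) ^ N * max (greenFun f w - t) 0)) fun n hn => ?_).trans
      (le_of_eq ?_)
  · refine (hC n w).trans ?_
    have hn' : n ≤ N := Nat.lt_succ_iff.1 (Finset.mem_range.1 hn)
    gcongr ?_ * Real.exp ?_
    calc (f.natDegree : ℝ) ^ n * (greenFun f w - t)
        ≤ (f.natDegree : ℝ) ^ n * max (greenFun f w - t) 0 := by
          gcongr
          exact le_max_left _ _
      _ ≤ _ := by gcongr
  · rw [Finset.sum_const, Finset.card_range, nsmul_eq_mul]
    push_cast
    ring

/-- Splitting off the first term gives `a 0 * v + S (f v) = c`, with `S` the shifted series.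
Differentiating at a critical point of `f` kills `a 0`, and then `S = c` everywhere because `f` is
onto. -/
theorem shift_of_iterateSeries_const {a : ℕ → ℂ}
    (ha : ∀ t, t ∈ doubleExpRates f.natDegree a) {c : ℂ} (hc : ∀ w, iterateSeries f a w = c) :
    a 0 = 0 ∧ (∀ t, t ∈ doubleExpRates f.natDegree (fun n => a (n + 1))) ∧
      ∀ w, iterateSeries f (fun n => a (n + 1)) w = c := by
  have h1 : (1 : ℝ) ≤ f.natDegree := by exact_mod_cast (by omega : 1 ≤ f.natDegree)
  have hb : ∀ t, t ∈ doubleExpRates f.natDegree (fun n => a (n + 1)) := by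
    intro t
    obtain ⟨C, hC⟩ := ha |t|
    refine ⟨|C|, fun n => (hC (n + 1)).trans ?_⟩
    gcongr ?_ * Real.exp (-?_)
    · exact le_abs_self C
    · rw [pow_succ, mul_assoc]
      gcongr
      exact (le_abs_self t).trans (le_mul_of_one_le_left (abs_nonneg t) h1)
  have hdec : ∀ v, a 0 * v + iterateSeries f (fun n => a (n + 1)) (f.eval v) = c := by
    intro v
    rw [← hc v, iterateSeries, iterateSeries,
      (summable_iterateSeries hf (ha _) (lt_add_one (greenFun f v))).tsum_eq_zero_add]
    rfl
  have ha0 : a 0 = 0 := by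
    obtain ⟨q, hq⟩ := IsAlgClosed.exists_root (Polynomial.derivative f) (by
      intro h
      have h0 : f.derivative.natDegree = 0 := Polynomial.natDegree_eq_of_degree_eq_some h
      rw [Polynomial.natDegree_derivative] at h0
      omega)
    have hS : DifferentiableAt ℂ (iterateSeries f (fun n => a (n + 1))) (f.eval q) :=
      (differentiableOn_iterateSeries hf (hb (greenFun f (f.eval q) + 1))).differentiableAt
        ((isOpen_lt (continuous_greenFun hf) continuous_const).mem_nhds
          (show greenFun f (f.eval q) < greenFun f (f.eval q) + 1 from lt_add_one _))
    have h2 := ((hasDerivAt_id q).const_mul (a 0)).add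
      (hS.hasDerivAt.comp q (f.hasDerivAt q))
    have h3 : HasDerivAt (fun _ : ℂ => c) 0 q := hasDerivAt_const q c
    have h4 := h3.unique (h2.congr_of_eventuallyEq (Eventually.of_forall fun v => (hdec v).symm))
    rw [hq.eq_zero] at h4
    simpa using h4.symm
  refine ⟨ha0, hb, fun w => ?_⟩
  obtain ⟨v, hv⟩ := IsAlgClosed.exists_root (f - Polynomial.C w) (by
    intro h
    have h0 : (f - Polynomial.C w).natDegree = 0 := Polynomial.natDegree_eq_of_degree_eq_some h
    rw [Polynomial.natDegree_sub_C] at h0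
    omega)
  have hv' : f.eval v = w := by
    simpa [sub_eq_zero] using hv
  have := hdec v
  rwa [ha0, zero_mul, zero_add, hv'] at this

/-- If the coefficients decay faster than every double exponential rate, then the entire function
`iterateSeries f a` is constant only if all coefficients vanish. -/
theorem eq_zero_of_iterateSeries_const {a : ℕ → ℂ}
    (ha : ∀ t, t ∈ doubleExpRates f.natDegree a) {c : ℂ} (hc : ∀ w, iterateSeries f a w = c)
    (n : ℕ) : a n = 0 := by
  induction n generalizing a with
  | zero => exact (shift_of_iterateSeries_const hf ha hc).1
  | succ n ih =>
    obtain ⟨-, hb, hcb⟩ := shift_of_iterateSeries_const hf ha hc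
    exact ih hb hcb

end Series

/-! ### Sublevel components and regular points of their boundary. -/

/-- The segment from a point of a component of `{G < e}` to a point with `e ≤ G` leaves the
component through the level set `{G = e}`. -/
theorem exists_mem_segment_level {G : ℂ → ℝ} (hG : Continuous G) {e : ℝ} {z q y : ℂ}
    (hq : q ∈ connectedComponentIn {w | G w < e} z) (hy : e ≤ G y) :
    ∃ p ∈ segment ℝ q y, G p = e ∧ p ∈ closure (connectedComponentIn {w | G w < e} z) := by
  set V := connectedComponentIn {w | G w < e} z
  have hVe : V ⊆ {w | G w < e} := connectedComponentIn_subset _ _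
  set γ : ℝ → ℂ := fun t => AffineMap.lineMap q y t
  have hγ : Continuous γ := AffineMap.lineMap_continuous
  set T : Set ℝ := Set.Icc 0 1 ∩ {t | e ≤ G (γ t)}
  have hT1 : (1 : ℝ) ∈ T := ⟨⟨zero_le_one, le_rfl⟩, by simpa [γ] using hy⟩
  have hTc : IsClosed T :=
    isClosed_Icc.inter (isClosed_le continuous_const (hG.comp hγ))
  have hTb : BddBelow T := ⟨0, fun t ht => ht.1.1⟩
  -- The first time at which the segment meets `{e ≤ G}`; until then it stays in the component.
  set t₀ := sInf T
  have ht₀ : t₀ ∈ T := hTc.csInf_mem ⟨1, hT1⟩ hTb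
  have hlt : ∀ t, 0 ≤ t → t < t₀ → G (γ t) < e := by
    intro t h0 ht
    by_contra! h
    exact absurd (csInf_le hTb ⟨⟨h0, ht.le.trans ht₀.1.2⟩, h⟩) (not_le.2 ht)
  have h0 : 0 < t₀ := by
    refine ht₀.1.1.lt_of_ne fun h => ?_
    have h1 : e ≤ G (γ t₀) := ht₀.2
    rw [← h] at h1
    simp only [γ, AffineMap.lineMap_apply_zero] at h1
    exact absurd (hVe hq) (not_lt.2 h1)
  have himg : γ '' Set.Ico 0 t₀ ⊆ V := by
    have hpre : IsPreconnected (γ '' Set.Ico 0 t₀) :=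
      isPreconnected_Ico.image _ hγ.continuousOn
    have := hpre.subset_connectedComponentIn (x := q) (F := {w | G w < e})
      ⟨0, ⟨le_rfl, h0⟩, by simp [γ]⟩ (by
        rintro _ ⟨t, ht, rfl⟩
        exact hlt t ht.1 ht.2)
    rwa [← connectedComponentIn_eq hq] at this
  have hcl : γ t₀ ∈ closure V := by
    refine closure_mono himg (image_closure_subset_closure_image hγ ⟨t₀, ?_, rfl⟩)
    rw [closure_Ico h0.ne]
    exact ⟨h0.le, le_rfl⟩
  refine ⟨γ t₀, ?_, le_antisymm ?_ ht₀.2, hcl⟩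
  · rw [segment_eq_image_lineMap]
    exact ⟨t₀, ht₀.1, rfl⟩
  · exact closure_minimal (fun w hw => (hVe hw).le) (isClosed_le hG continuous_const) hcl

/-- Near a regular point of a level line, the sublevel set is connected. -/
theorem exists_ball_sublevel_subset {G : ℂ → ℝ} {e r : ℝ} {z p : ℂ} (hr : 0 < r) {L : ℂ → ℂ}
    (hL : DifferentiableOn ℂ L (Metric.ball p r)) (hLG : ∀ w ∈ Metric.ball p r, (L w).re = G w)
    (hLp : deriv L p ≠ 0) (hp : p ∈ closure (connectedComponentIn {w | G w < e} z)) :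
    ∃ ρ > 0, ∀ w ∈ Metric.ball p ρ, G w < e → w ∈ connectedComponentIn {w | G w < e} z := by
  set V := connectedComponentIn {w | G w < e} z
  have hVe : V ⊆ {w | G w < e} := connectedComponentIn_subset _ _
  have han : AnalyticAt ℂ L p := hL.analyticAt (Metric.ball_mem_nhds p hr)
  have hs : HasStrictDerivAt L (deriv L p) p := han.hasStrictDerivAt
  set h := (hs.hasStrictFDerivAt_equiv hLp).toOpenPartialHomeomorph L with hh
  have hcoe : ∀ w, h w = L w := fun w => rfl
  have hps : p ∈ h.source := (hs.hasStrictFDerivAt_equiv hLp).mem_toOpenPartialHomeomorph_source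
  have hopen : IsOpen (h.target ∩ h.symm ⁻¹' Metric.ball p r) :=
    h.isOpen_inter_preimage_symm Metric.isOpen_ball
  have hLpm : L p ∈ h.target ∩ h.symm ⁻¹' Metric.ball p r := by
    rw [← hcoe]
    refine ⟨h.map_source hps, ?_⟩
    rw [Set.mem_preimage, h.left_inv hps]
    exact Metric.mem_ball_self hr
  obtain ⟨ε, hε, hεs⟩ := Metric.isOpen_iff.1 hopen _ hLpm
  -- In the coordinate `L` the sublevel set is a half-plane, whose intersection with a disc is
  -- convex, hence connected.
  set A := h.symm '' (Metric.ball (L p) ε ∩ {s | s.re < e})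
  have hA : IsPreconnected A := by
    refine ((convex_ball (L p) ε).inter (convex_halfSpace_re_lt e)).isPreconnected.image _ ?_
    exact h.continuousOn_symm.mono fun s hs => (hεs hs.1).1
  have hre : ∀ s ∈ Metric.ball (L p) ε, G (h.symm s) = s.re := by
    intro s hs
    rw [← hLG _ (hεs hs).2, ← hcoe, h.right_inv (hεs hs).1]
  have hAe : A ⊆ {w | G w < e} := by
    rintro _ ⟨s, ⟨hs1, hs2⟩, rfl⟩
    change G (h.symm s) < e
    rw [hre s hs1]
    exact hs2
  have hN : h.source ∩ h ⁻¹' Metric.ball (L p) ε ∈ 𝓝 p :=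
    (h.isOpen_inter_preimage Metric.isOpen_ball).mem_nhds ⟨hps, Metric.mem_ball_self hε⟩
  have hNA : ∀ w ∈ h.source ∩ h ⁻¹' Metric.ball (L p) ε, G w < e → w ∈ A := by
    rintro w ⟨hw1, hw2⟩ hwe
    refine ⟨h w, ⟨hw2, ?_⟩, h.left_inv hw1⟩
    have := hre _ hw2
    rw [h.left_inv hw1] at this
    change (h w).re < e
    rwa [← this]
  obtain ⟨x, hxN, hxV⟩ := mem_closure_iff_nhds.1 hp _ hN
  have hAV : A ⊆ V := by
    have := hA.subset_connectedComponentIn (hNA x hxN (hVe hxV)) hAe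
    rwa [← connectedComponentIn_eq hxV] at this
  obtain ⟨ρ, hρ, hρN⟩ := Metric.mem_nhds_iff.1 hN
  exact ⟨ρ, hρ, fun w hw hwe => hAV (hNA w (hρN hw) hwe)⟩

/-- Only points `y` on the line through `p` and `q` can fail, and the complement of that line is
dense. -/
theorem exists_mem_notMem_segment {O : Set ℂ} (hO : IsOpen O) (hne : O.Nonempty) {p q : ℂ}
    (hqp : q ≠ p) : ∃ y ∈ O, p ∉ segment ℝ q y := by
  have hc : q - p ≠ 0 := sub_ne_zero.2 hqp
  have hm : IsOpenMap fun w : ℂ => ((w + -p) * (q - p)⁻¹).im :=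
    Complex.isOpenMap_im.comp
      ((Homeomorph.mulRight₀ _ (inv_ne_zero hc)).isOpenMap.comp (Homeomorph.addRight (-p)).isOpenMap)
  obtain ⟨y, hyO, hy⟩ := ((dense_compl_singleton (0 : ℝ)).preimage hm).inter_open_nonempty O hO hne
  refine ⟨y, hyO, ?_⟩
  rintro ⟨a, b, ha, hb, hab, h⟩
  have h1 : (b : ℂ) * ((y + -p) * (q - p)⁻¹) = -a := by
    have hab' : (a : ℂ) = 1 - b := by
      rw [← Complex.ofReal_one, ← Complex.ofReal_sub, ← hab, add_sub_cancel_right]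
    rw [← mul_assoc, ← div_eq_mul_inv, div_eq_iff hc, hab']
    rw [Complex.real_smul, Complex.real_smul, hab'] at h
    linear_combination h
  have h2 := congrArg Complex.im h1
  rw [Complex.im_ofReal_mul, Complex.neg_im, Complex.ofReal_im, neg_zero] at h2
  have hb0 : b = 0 := (mul_eq_zero.1 h2).resolve_right hy
  rw [hb0, add_zero] at hab
  rw [hab, hb0, one_smul, zero_smul, add_zero] at h
  exact hqp h

/-- If `G` is locally the real part of a holomorphic function, then the boundary of any component
of `{G < e}` has a regular point. -/
theorem exists_regular_boundary_point {G : ℂ → ℝ} (hG : Continuous G) {e : ℝ}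
    (hloc : ∀ p, G p = e → ∃ r > 0, ∃ L : ℂ → ℂ, DifferentiableOn ℂ L (Metric.ball p r) ∧
      ∀ w ∈ Metric.ball p r, (L w).re = G w) {z y : ℂ} (hz : G z < e) (hy : e ≤ G y) :
    ∃ p, G p = e ∧ p ∈ closure (connectedComponentIn {w | G w < e} z) ∧ ∃ r > 0, ∃ L : ℂ → ℂ,
      DifferentiableOn ℂ L (Metric.ball p r) ∧ (∀ w ∈ Metric.ball p r, (L w).re = G w) ∧
      deriv L p ≠ 0 := by
  obtain ⟨p, -, hpe, hp⟩ :=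
    exists_mem_segment_level hG (mem_connectedComponentIn (F := {w | G w < e}) hz) hy
  set V := connectedComponentIn {w | G w < e} z
  have hVe : V ⊆ {w | G w < e} := connectedComponentIn_subset _ _
  obtain ⟨r, hr, L, hL, hLG⟩ := hloc p hpe
  have hball : ∀ {ρ}, 0 < ρ → ∃ q ∈ V, q ∈ Metric.ball p ρ := fun hρ => by
    obtain ⟨q, hq1, hq2⟩ := mem_closure_iff_nhds.1 hp _ (Metric.ball_mem_nhds p hρ)
    exact ⟨q, hq2, hq1⟩
  have han : AnalyticAt ℂ L p := hL.analyticAt (Metric.ball_mem_nhds p hr)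
  -- `L` is not constant near `p`, since `V` accumulates there. So `L` is open and its critical
  -- points are isolated: if `p` is critical, a nearby boundary point is not.
  have hnc : ¬ ∀ᶠ w in 𝓝 p, L w = L p := by
    intro h
    obtain ⟨ρ, hρ, hρs⟩ := Metric.mem_nhds_iff.1 h
    obtain ⟨q, hqV, hq⟩ := hball (lt_min hr hρ)
    have h1 : L q = L p := hρs (Metric.ball_subset_ball (min_le_right _ _) hq)
    have h2 := hLG q (Metric.ball_subset_ball (min_le_left _ _) hq)
    rw [h1, hLG p (Metric.mem_ball_self hr), hpe] at h2
    exact absurd (hVe hqV) (not_lt.2 h2.le)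
  have hopen := han.eventually_constant_or_nhds_le_map_nhds.resolve_left hnc
  have hd : ∀ᶠ w in 𝓝[≠] p, deriv L w ≠ 0 := by
    refine han.deriv.eventually_eq_zero_or_eventually_ne_zero.resolve_left fun h => hnc ?_
    obtain ⟨ρ, hρ, hρs⟩ := Metric.mem_nhds_iff.1 h
    filter_upwards [Metric.ball_mem_nhds p (lt_min hr hρ)] with w hw
    refine Metric.isOpen_ball.is_const_of_deriv_eq_zero
      (convex_ball p (min r ρ)).isPreconnected
      (hL.mono (Metric.ball_subset_ball (min_le_left _ _))) (fun x hx => ?_) hw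
      (Metric.mem_ball_self (lt_min hr hρ))
    exact hρs (Metric.ball_subset_ball (min_le_right _ _) hx)
  obtain ⟨ρ, hρ, hρs⟩ := Metric.mem_nhds_iff.1 (eventually_nhdsWithin_iff.1 hd)
  obtain ⟨q, hqV, hq⟩ := hball (lt_min hr hρ)
  set O := Metric.ball p (min r ρ) ∩ {w | e < G w}
  have hO : IsOpen O := Metric.isOpen_ball.inter (isOpen_lt continuous_const hG)
  have hOne : O.Nonempty := by
    have h1 : L '' Metric.ball p (min r ρ) ∈ 𝓝 (L p) :=
      hopen (image_mem_map (Metric.ball_mem_nhds p (lt_min hr hρ)))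
    have h2 : Tendsto (fun t : ℝ => L p + t) (𝓝[>] 0) (𝓝 (L p)) := by
      have : Continuous fun t : ℝ => L p + t := by fun_prop
      simpa using (this.tendsto 0).mono_left nhdsWithin_le_nhds
    obtain ⟨t, ⟨w, hw, hwt⟩, ht⟩ := ((h2.eventually h1).and self_mem_nhdsWithin).exists
    refine ⟨w, hw, ?_⟩
    change e < G w
    rw [← hLG w (Metric.ball_subset_ball (min_le_left _ _) hw), hwt, Complex.add_re,
      Complex.ofReal_re, hLG p (Metric.mem_ball_self hr), hpe]
    exact lt_add_of_pos_right _ ht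
  have hqp : q ≠ p := by
    rintro rfl
    exact absurd (hVe hqV) (not_lt.2 hpe.ge)
  -- A segment from `V` to `{e < G}` inside the ball that avoids `p` must exit `V` at a boundary
  -- point other than `p`.
  obtain ⟨y', hy'O, hy'⟩ := exists_mem_notMem_segment hO hOne hqp
  obtain ⟨p', hp's, hp'e, hp'⟩ := exists_mem_segment_level hG hqV hy'O.2.le
  have hp'b : p' ∈ Metric.ball p (min r ρ) :=
    (convex_ball p (min r ρ)).segment_subset hq hy'O.1 hp's
  have hp'p : p' ≠ p := by
    rintro rfl
    exact hy' hp's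
  obtain ⟨r', hr', hsub⟩ := Metric.isOpen_iff.1 Metric.isOpen_ball p' hp'b
  have hsub' : Metric.ball p' r' ⊆ Metric.ball p r :=
    hsub.trans (Metric.ball_subset_ball (min_le_left _ _))
  exact ⟨p', hp'e, hp', r', hr', L, hL.mono hsub', fun w hw => hLG w (hsub' hw),
    hρs (Metric.ball_subset_ball (min_le_right _ _) hp'b) hp'p⟩

/-! ### Two constants theorem and overconvergence. -/

/-- A form of the two constants theorem for a disc: a bound that is better on an arc of the
boundary circle improves the bound at the centre. -/
theorem exists_norm_pow_le_mul_pow {p x : ℂ} {r η : ℝ} (hr : 0 < r) (hη : 0 < η)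
    (hx : x ∈ Metric.sphere p r) : ∃ m : ℕ, ∀ (H : ℂ → ℂ) (b B : ℝ), 0 ≤ b →
      DifferentiableOn ℂ H (Metric.closedBall p r) →
      (∀ w ∈ Metric.sphere p r, ‖H w‖ ≤ B) →
      (∀ w ∈ Metric.sphere p r, dist w x < η → ‖H w‖ ≤ b) → ‖H p‖ ^ (m + 1) ≤ b * B ^ m := by
  classical
  -- Finitely many rotations of the arc cover the circle. The maximum principle is applied to the
  -- product of the rotated copies of `H`: on the circle some factor is at most `b`, and at the
  -- centre the product is a power of `H p`.
  have hcov : ∀ v ∈ Metric.sphere (0 : ℂ) r, ∃ u ∈ Metric.sphere (0 : ℂ) 1,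
      dist (p + u * v) x < η := by
    intro v hv
    have hvr : ‖v‖ = r := by simpa using hv
    have hv0 : v ≠ 0 := norm_pos_iff.1 (by rw [hvr]; exact hr)
    refine ⟨(x - p) / v, ?_, ?_⟩
    · rw [mem_sphere_zero_iff_norm, norm_div, hvr, ← dist_eq_norm, hx, div_self hr.ne']
    · rw [div_mul_cancel₀ _ hv0, add_sub_cancel, dist_self]
      exact hη
  obtain ⟨t, ht, htc⟩ := (isCompact_sphere (0 : ℂ) r).elim_finite_subcover_image
    (b := Metric.sphere (0 : ℂ) 1) (c := fun u => {v | dist (p + u * v) x < η})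
    (fun u _ => isOpen_lt (by fun_prop) continuous_const)
    (fun v hv => by
      obtain ⟨u, hu, huv⟩ := hcov v hv
      exact Set.mem_biUnion hu huv)
  obtain ⟨htf, htc⟩ := htc
  set T := htf.toFinset with hT
  have hTcov : ∀ v ∈ Metric.sphere (0 : ℂ) r, ∃ u ∈ T, dist (p + u * v) x < η := by
    intro v hv
    obtain ⟨u, hu, huv⟩ := Set.mem_iUnion₂.1 (htc hv)
    exact ⟨u, htf.mem_toFinset.2 hu, huv⟩
  have hTn : ∀ u ∈ T, ‖u‖ = 1 := fun u hu => by simpa using ht (htf.mem_toFinset.1 hu)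
  have hTcard : 0 < T.card := by
    obtain ⟨u, hu, -⟩ := hTcov r (by simp [abs_of_pos hr])
    exact Finset.card_pos.2 ⟨u, hu⟩
  refine ⟨T.card - 1, fun H b B hb hH hB hHb => ?_⟩
  have hmaps : ∀ u ∈ T, Set.MapsTo (fun v => p + u * v) (Metric.closedBall 0 r)
      (Metric.closedBall p r) := by
    intro u hu v hv
    simpa [hTn u hu] using hv
  have hmaps' : ∀ u ∈ T, ∀ v ∈ Metric.sphere (0 : ℂ) r, p + u * v ∈ Metric.sphere p r := by
    intro u hu v hv
    simpa [hTn u hu] using hv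
  have hd : DifferentiableOn ℂ (fun v => ∏ u ∈ T, H (p + u * v)) (Metric.closedBall 0 r) :=
    DifferentiableOn.fun_finsetProd fun u hu => hH.comp (by fun_prop) (hmaps u hu)
  have hfr : ∀ v ∈ frontier (Metric.ball (0 : ℂ) r),
      ‖∏ u ∈ T, H (p + u * v)‖ ≤ b * B ^ (T.card - 1) := by
    intro v hv
    rw [frontier_ball _ hr.ne'] at hv
    obtain ⟨u₀, hu₀, hdist⟩ := hTcov v hv
    rw [norm_prod, ← Finset.mul_prod_erase T _ hu₀, ← Finset.card_erase_of_mem hu₀]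
    refine mul_le_mul (hHb _ (hmaps' u₀ hu₀ v hv) hdist) ?_
      (Finset.prod_nonneg fun _ _ => norm_nonneg _) hb
    rw [← Finset.prod_const]
    exact Finset.prod_le_prod (fun _ _ => norm_nonneg _) fun u hu =>
      hB _ (hmaps' u (Finset.mem_of_mem_erase hu) v hv)
  have h0 := Complex.norm_le_of_forall_mem_frontier_norm_le Metric.isBounded_ball
    (DifferentiableOn.diffContOnCl (by rwa [closure_ball _ hr.ne'])) hfr
    (subset_closure (Metric.mem_ball_self hr))
  simp only [mul_zero, add_zero, Finset.prod_const, norm_pow] at h0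
  rwa [Nat.sub_add_cancel hTcard]

section Overconvergence

variable {f : Polynomial ℂ} (hf : 2 ≤ f.natDegree)
include hf


/-- The weight cancels the growth of `S_N` for `G > e`. Below the level, `S_N - c` is a tail with
exponent `d^(N+1) ≥ 2 d^N`, so a decaying factor survives the weight. The loss in `δ` arises because
`e` itself need not be a rate. -/
theorem exists_weighted_bounds {a : ℕ → ℂ} {e δ : ℝ} {c : ℂ} {O : Set ℂ} (hδ : 0 < δ)
    (ht : e - δ ∈ doubleExpRates f.natDegree a)
    (hS : ∀ w ∈ O, greenFun f w < e → iterateSeries f a w = c) :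
    ∃ M : ℝ, 0 ≤ M ∧ ∀ N : ℕ, ∀ w ∈ O,
      ‖iterateSum f a N w - c‖ * Real.exp (-((f.natDegree : ℝ) ^ N * (greenFun f w - e))) ≤
        M * (N + 1) * Real.exp ((f.natDegree : ℝ) ^ N * (2 * δ)) ∧
      (greenFun f w ≤ e - 2 * δ →
        ‖iterateSum f a N w - c‖ * Real.exp (-((f.natDegree : ℝ) ^ N * (greenFun f w - e))) ≤
          M * (N + 1) * Real.exp ((f.natDegree : ℝ) ^ N * (greenFun f w - e + 2 * δ))) := by
  obtain ⟨K, hK0, hK⟩ := exists_norm_iterateSeries_sub_le hf ht hδ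
  obtain ⟨C, hC0, hC⟩ := exists_norm_iterateSum_le hf ht
  have h2 : (2 : ℝ) ≤ f.natDegree := by exact_mod_cast hf
  refine ⟨K + (C + ‖c‖), by positivity, fun N w hw => ?_⟩
  have hD : 0 < (f.natDegree : ℝ) ^ N := by positivity
  set D := (f.natDegree : ℝ) ^ N with hDdef
  have hN : (1 : ℝ) ≤ N + 1 := by linarith [Nat.cast_nonneg (α := ℝ) N]
  have hsmall : greenFun f w ≤ e - 2 * δ →
      ‖iterateSum f a N w - c‖ * Real.exp (-(D * (greenFun f w - e))) ≤
        (K + (C + ‖c‖)) * (N + 1) * Real.exp (D * (greenFun f w - e + 2 * δ)) := by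
    intro hle
    have h3 := hK N w (by linarith)
    rw [hS w hw (by linarith), norm_sub_rev] at h3
    calc ‖iterateSum f a N w - c‖ * Real.exp (-(D * (greenFun f w - e)))
        ≤ K * Real.exp ((f.natDegree : ℝ) ^ (N + 1) * (greenFun f w - (e - δ))) *
          Real.exp (-(D * (greenFun f w - e))) := by gcongr
      _ = K * Real.exp ((f.natDegree : ℝ) ^ (N + 1) * (greenFun f w - (e - δ)) +
          -(D * (greenFun f w - e))) := by rw [mul_assoc, ← Real.exp_add]
      _ ≤ K * Real.exp (D * (greenFun f w - e + 2 * δ)) := by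
          gcongr
          rw [pow_succ, ← hDdef]
          have h4 : f.natDegree * (greenFun f w - (e - δ)) ≤ 2 * (greenFun f w - (e - δ)) :=
            mul_le_mul_of_nonpos_right h2 (by linarith)
          nlinarith
      _ ≤ (K + (C + ‖c‖)) * (N + 1) * Real.exp (D * (greenFun f w - e + 2 * δ)) := by
          gcongr
          nlinarith [norm_nonneg c]
  refine ⟨?_, hsmall⟩
  rcases le_or_gt (greenFun f w) (e - 2 * δ) with hle | hlt
  · refine (hsmall hle).trans ?_
    gcongr
    linarith
  · set m := max (greenFun f w - (e - δ)) 0 with hm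
    have hm0 : 0 ≤ m := le_max_right _ _
    have hm1 : m - (greenFun f w - e) ≤ 2 * δ := by
      rw [sub_le_iff_le_add]
      apply max_le <;> linarith
    calc ‖iterateSum f a N w - c‖ * Real.exp (-(D * (greenFun f w - e)))
        ≤ (C * (N + 1) * Real.exp (D * m) + ‖c‖) * Real.exp (-(D * (greenFun f w - e))) := by
          gcongr
          exact (norm_sub_le _ _).trans (add_le_add_left (hC N w) _)
      _ ≤ ((C + ‖c‖) * (N + 1) * Real.exp (D * m)) * Real.exp (-(D * (greenFun f w - e))) := by
          gcongr
          have h5 : 1 ≤ (N + 1) * Real.exp (D * m) :=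
            one_le_mul_of_one_le_of_one_le hN (Real.one_le_exp (by positivity))
          nlinarith [norm_nonneg c]
      _ = (C + ‖c‖) * (N + 1) * Real.exp (D * (m - (greenFun f w - e))) := by
          rw [mul_assoc, ← Real.exp_add]
          congr 2
          ring
      _ ≤ _ := by
          gcongr ?_ * _ * Real.exp (_ * ?_)
          exact le_add_of_nonneg_left hK0

/-- Overconvergence: if the series is constant inside `{greenFun f < e}` near a regular boundary
point `p`, then the partial sums converge at `p` doubly exponentially fast. -/
theorem exists_norm_iterateSum_sub_le {a : ℕ → ℂ} {e r : ℝ} {c p : ℂ} {L : ℂ → ℂ}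
    (hT : ∀ t < e, t ∈ doubleExpRates f.natDegree a)
    (hL : DifferentiableOn ℂ L (Metric.ball p r))
    (hLG : ∀ w ∈ Metric.ball p r, (L w).re = greenFun f w) (hpe : greenFun f p = e)
    (hS : ∀ w ∈ Metric.ball p r, greenFun f w < e → iterateSeries f a w = c)
    {x : ℂ} (hxr : x ∈ Metric.ball p r) (hxe : greenFun f x < e) :
    ∃ μ : ℝ, 0 < μ ∧ ∃ M : ℝ, 0 ≤ M ∧ ∀ N : ℕ, ‖iterateSum f a N p - c‖ ≤
      M * (N + 1) * Real.exp (-((f.natDegree : ℝ) ^ N * μ)) := by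
  have hxp : x ≠ p := by
    rintro rfl
    exact hxe.ne hpe
  have hs : 0 < dist x p := dist_pos.2 hxp
  have hsub : Metric.closedBall p (dist x p) ⊆ Metric.ball p r :=
    Metric.closedBall_subset_ball hxr
  set κ := (e - greenFun f x) / 3 with hκ
  have hκ0 : 0 < κ := by linarith
  obtain ⟨η, hη, hηG⟩ := Metric.continuousAt_iff.1 (continuous_greenFun hf).continuousAt κ hκ0
  have harc : ∀ w, dist w x < η → greenFun f w ≤ e - 2 * κ := by
    intro w hw
    have := (abs_lt.1 (hηG hw)).2
    linarith
  obtain ⟨m, hm⟩ := exists_norm_pow_le_mul_pow hs hη (Metric.mem_sphere.2 rfl)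
  have hm1 : (1 : ℝ) ≤ m + 1 := by linarith [Nat.cast_nonneg (α := ℝ) m]
  -- With gain `κ` on the arc and loss `2 * δ` elsewhere, the two constants bound has exponent `-κ +
  -- 2 * δ * m`, at most `-2 * δ * (m + 1)`.
  set δ := κ / (4 * (m + 1)) with hδ
  have hδ0 : 0 < δ := by positivity
  have hδm : δ * (4 * (m + 1)) = κ := by
    rw [hδ]
    field_simp
  have hδκ : 4 * δ ≤ κ := by nlinarith
  obtain ⟨M, hM0, hM⟩ := exists_weighted_bounds hf hδ0 (hT (e - δ) (by linarith)) hS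
  refine ⟨2 * δ, by positivity, M, hM0, fun N => ?_⟩
  have h2 : (2 : ℝ) ≤ f.natDegree := by exact_mod_cast hf
  have hD : 0 < (f.natDegree : ℝ) ^ N := by positivity
  set D := (f.natDegree : ℝ) ^ N with hDdef
  -- Since `Re L = G`, the modulus of the exponential is the weight, which equals `1` at `p`.
  set H : ℂ → ℂ := fun w => (iterateSum f a N w - c) * Complex.exp (-(D * (L w - e)))
  have hHn : ∀ w ∈ Metric.ball p r, ‖H w‖ =
      ‖iterateSum f a N w - c‖ * Real.exp (-(D * (greenFun f w - e))) := by
    intro w hw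
    rw [norm_mul, Complex.norm_exp, Complex.neg_re, Complex.re_ofReal_mul, Complex.sub_re,
      Complex.ofReal_re, hLG w hw]
  have hHd : DifferentiableOn ℂ H (Metric.closedBall p (dist x p)) := by
    have h3 : Differentiable ℂ (iterateSum f a N) := by
      unfold iterateSum
      exact Differentiable.fun_sum fun n _ => (f.differentiable_iterate_eval n).const_mul _
    have h4 := hL.mono hsub
    exact (h3.differentiableOn.sub_const c).mul
      ((h4.sub_const (e : ℂ)).const_mul (D : ℂ)).neg.cexp
  have hpr : p ∈ Metric.ball p r := hsub (Metric.mem_closedBall_self hs.le)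
  have key := hm H (M * (N + 1) * Real.exp (-(D * κ))) (M * (N + 1) * Real.exp (D * (2 * δ)))
    (by positivity) hHd
    (fun w hw => by
      have hwr := hsub (Metric.sphere_subset_closedBall hw)
      rw [hHn w hwr]
      exact (hM N w hwr).1)
    (fun w hw hwx => by
      have hwr := hsub (Metric.sphere_subset_closedBall hw)
      have hwG := harc w hwx
      rw [hHn w hwr]
      refine ((hM N w hwr).2 (by linarith)).trans ?_
      gcongr
      nlinarith)
  rw [hHn p hpr, hpe, sub_self, mul_zero, neg_zero, Real.exp_zero, mul_one] at key
  refine le_of_pow_le_pow_left₀ (Nat.succ_ne_zero m) (by positivity) (key.trans ?_)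
  rw [mul_pow _ (Real.exp (D * (2 * δ))), mul_pow _ (Real.exp (-(D * (2 * δ)))), ← Real.exp_nat_mul,
    ← Real.exp_nat_mul, mul_mul_mul_comm, ← pow_succ', ← Real.exp_add, Nat.succ_eq_add_one]
  gcongr
  rw [← hδm]
  push_cast
  nlinarith [mul_pos hD hδ0]

/-- At an escaping point `|f^n p|` is eventually at least `exp(d^n G p) / C`; dividing by it adds `G
p` to the rate. -/
theorem mem_doubleExpRates_of_norm_mul_le {a : ℕ → ℂ} {p : ℂ} (hp : 0 < greenFun f p) {A τ : ℝ}
    (h : ∀ᶠ n in atTop, ‖a n * (fun w => f.eval w)^[n] p‖ ≤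
      A * Real.exp (-((f.natDegree : ℝ) ^ n * τ))) :
    greenFun f p + τ ∈ doubleExpRates f.natDegree a := by
  obtain ⟨C, hC1, hC⟩ := exists_iterate_bounds hf
  have h1 : (1 : ℝ) < f.natDegree := by exact_mod_cast hf
  have ht : Tendsto (fun n : ℕ => Real.exp ((f.natDegree : ℝ) ^ n * greenFun f p)) atTop atTop :=
    Real.tendsto_exp_atTop.comp ((tendsto_pow_atTop_atTop_of_one_lt h1).atTop_mul_const hp)
  refine mem_doubleExpRates_of_eventually (C := A * C) ?_
  filter_upwards [h, ht.eventually_gt_atTop C] with n hn hCn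
  set v := (fun w => f.eval w)^[n] p
  have hv := (hC n p).2
  have hv1 : Real.exp ((f.natDegree : ℝ) ^ n * greenFun f p) ≤ C * ‖v‖ := by
    rcases le_total ‖v‖ 1 with h | h
    · rw [max_eq_left h, mul_one] at hv
      exact absurd hCn (not_lt.2 hv)
    · rwa [max_eq_right h] at hv
  rw [norm_mul] at hn
  have h3 : ‖a n‖ * Real.exp ((f.natDegree : ℝ) ^ n * greenFun f p) ≤
      A * C * Real.exp (-((f.natDegree : ℝ) ^ n * τ)) := by
    calc ‖a n‖ * Real.exp ((f.natDegree : ℝ) ^ n * greenFun f p) ≤ ‖a n‖ * (C * ‖v‖) := by gcongr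
      _ = C * (‖a n‖ * ‖v‖) := by ring
      _ ≤ C * (A * Real.exp (-((f.natDegree : ℝ) ^ n * τ))) := by gcongr
      _ = _ := by ring
  rw [mul_add, neg_add_rev, Real.exp_add, ← mul_assoc, Real.exp_neg (_ * greenFun f p),
    ← div_eq_mul_inv, le_div_iff₀ (Real.exp_pos _)]
  exact h3

omit hf in
theorem iterateSum_succ_sub (a : ℕ → ℂ) (N : ℕ) (w : ℂ) :
    iterateSum f a (N + 1) w - iterateSum f a N w = a (N + 1) * (fun w => f.eval w)^[N + 1] w := by
  rw [iterateSum, iterateSum, Finset.sum_range_succ _ (N + 1), add_sub_cancel_left]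

theorem exists_gt_mem_doubleExpRates {a : ℕ → ℂ} {p c : ℂ} (hp : 0 < greenFun f p) {μ M : ℝ}
    (hμ : 0 < μ) (hM : 0 ≤ M) (h : ∀ N : ℕ, ‖iterateSum f a N p - c‖ ≤
      M * (N + 1) * Real.exp (-((f.natDegree : ℝ) ^ N * μ))) :
    ∃ t > greenFun f p, t ∈ doubleExpRates f.natDegree a := by
  have h2 : (2 : ℝ) ≤ f.natDegree := by exact_mod_cast hf
  have hd0 : (0 : ℝ) < f.natDegree := by linarith
  -- Half of `μ` absorbs the factor linear in `N`; division by `d` accounts for bounding the term of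
  -- index `N + 1` with exponent `d^N`.
  refine ⟨greenFun f p + μ / 2 / f.natDegree, lt_add_of_pos_right _ (by positivity),
    mem_doubleExpRates_of_norm_mul_le hf hp (A := 2 * M * (4 / μ)) ?_⟩
  filter_upwards [eventually_ge_atTop 1] with n hn
  obtain ⟨N, rfl⟩ := Nat.exists_eq_add_of_le' hn
  rw [← iterateSum_succ_sub]
  set D := (f.natDegree : ℝ) ^ N with hD
  have hD0 : 0 < D := by positivity
  have hN0 : (0 : ℝ) ≤ N := Nat.cast_nonneg N
  have hND : (N : ℝ) + 2 ≤ 2 * D := by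
    have := add_natCast_le_natPow_add hf 0 N
    rw [zero_add, pow_zero] at this
    linarith
  have hexp : D * (μ / 2) ≤ Real.exp (D * (μ / 2)) := by
    linarith [Real.add_one_le_exp (D * (μ / 2))]
  have hNexp : (N : ℝ) + 2 ≤ 4 / μ * Real.exp (D * (μ / 2)) := by
    calc (N : ℝ) + 2 ≤ 2 * D := hND
      _ = 4 / μ * (D * (μ / 2)) := by field_simp; ring
      _ ≤ _ := by gcongr
  have e1 : (f.natDegree : ℝ) ^ (N + 1) * (μ / 2 / f.natDegree) = D * (μ / 2) := by
    rw [pow_succ, ← hD]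
    field_simp
  have hDs : D ≤ (f.natDegree : ℝ) ^ (N + 1) := by
    rw [pow_succ]
    exact le_mul_of_one_le_right hD0.le (by linarith)
  have hb1 : ‖iterateSum f a (N + 1) p - c‖ ≤ M * (N + 2) * Real.exp (-(D * μ)) := by
    refine (h (N + 1)).trans ?_
    push_cast
    gcongr ?_ * Real.exp (-?_)
    · gcongr M * ?_
      linarith
    · gcongr
  have hb2 : ‖iterateSum f a N p - c‖ ≤ M * (N + 2) * Real.exp (-(D * μ)) := by
    refine (h N).trans ?_
    gcongr
    norm_num
  rw [e1]
  calc ‖iterateSum f a (N + 1) p - iterateSum f a N p‖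
      = ‖(iterateSum f a (N + 1) p - c) - (iterateSum f a N p - c)‖ := by
        rw [sub_sub_sub_cancel_right]
    _ ≤ M * (N + 2) * Real.exp (-(D * μ)) + M * (N + 2) * Real.exp (-(D * μ)) :=
        (norm_sub_le _ _).trans (add_le_add hb1 hb2)
    _ = 2 * M * (N + 2) * Real.exp (-(D * μ)) := by ring
    _ ≤ 2 * M * (4 / μ * Real.exp (D * (μ / 2))) * Real.exp (-(D * μ)) := by gcongr
    _ = 2 * M * (4 / μ) * (Real.exp (D * (μ / 2)) * Real.exp (-(D * μ))) := by ring
    _ = _ := by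
      rw [← Real.exp_add]
      congr 2
      ring

end Overconvergence

/-! ### Vanishing of the weights. -/

section TimeAverage

variable {f : Polynomial ℂ} (hf : 2 ≤ f.natDegree)
include hf

theorem exists_le_greenFun {x : ℂ} (hx : 0 < greenFun f x) (e : ℝ) : ∃ y, e ≤ greenFun f y := by
  have h1 : (1 : ℝ) < f.natDegree := by exact_mod_cast hf
  obtain ⟨n, hn⟩ := (((tendsto_pow_atTop_atTop_of_one_lt h1).atTop_mul_const
    hx).eventually_ge_atTop e).exists
  exact ⟨_, hn.trans (greenFun_iterate hf n x).ge⟩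

theorem greenFun_mem_doubleExpRates {a : ℕ → ℂ} {x c : ℂ} (hx : 0 < greenFun f x)
    (h : Tendsto (fun N => iterateSum f a N x) atTop (𝓝 c)) :
    greenFun f x ∈ doubleExpRates f.natDegree a := by
  have h1 : Tendsto (fun N => a (N + 1) * (fun w => f.eval w)^[N + 1] x) atTop (𝓝 0) := by
    have := ((tendsto_add_atTop_iff_nat 1).2 h).sub h
    rw [sub_self] at this
    exact this.congr fun N => iterateSum_succ_sub a N x
  have h2 : Tendsto (fun n => a n * (fun w => f.eval w)^[n] x) atTop (𝓝 0) :=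
    (tendsto_add_atTop_iff_nat (f := fun n => a n * (fun w => f.eval w)^[n] x) 1).1 h1
  have h3 := mem_doubleExpRates_of_norm_mul_le hf hx (a := a) (A := 1) (τ := 0) (by
    filter_upwards [h2.norm.eventually_le_const (u := 1) (by simp)] with n hn
    simpa using hn)
  rwa [add_zero] at h3

/-- If the series sums to a constant near `z`, it does so on the whole component of the domain of
convergence that contains `z`. -/
theorem iterateSeries_eqOn_connectedComponentIn {a : ℕ → ℂ} {e : ℝ} {z c : ℂ}
    (hT : ∀ t < e, t ∈ doubleExpRates f.natDegree a) (hz : greenFun f z < e)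
    (h : ∀ᶠ w in 𝓝 z, Tendsto (fun N => iterateSum f a N w) atTop (𝓝 c)) :
    Set.EqOn (iterateSeries f a) (fun _ => c)
      (connectedComponentIn {w | greenFun f w < e} z) := by
  have hopen : ∀ t, IsOpen {w | greenFun f w < t} := fun t =>
    isOpen_lt (continuous_greenFun hf) continuous_const
  set V := connectedComponentIn {w | greenFun f w < e} z
  have hVe : V ⊆ {w | greenFun f w < e} := connectedComponentIn_subset _ _
  have hV : IsOpen V := (hopen e).connectedComponentIn
  have hd : DifferentiableOn ℂ (iterateSeries f a) V := fun w hw => by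
    obtain ⟨t, ht1, ht2⟩ := exists_between (show greenFun f w < e from hVe hw)
    exact ((differentiableOn_iterateSeries hf (hT t ht2)).differentiableAt
      ((hopen t).mem_nhds ht1)).differentiableWithinAt
  refine (hd.analyticOnNhd hV).eqOn_of_preconnected_of_eventuallyEq analyticOnNhd_const
    isPreconnected_connectedComponentIn (mem_connectedComponentIn hz) ?_
  filter_upwards [h, (hopen e).mem_nhds hz] with w hw hwe
  obtain ⟨t, ht1, ht2⟩ := exists_between (show greenFun f w < e from hwe)
  have h1 := ((summable_iterateSeries hf (hT t ht2) ht1).hasSum.tendsto_sum_nat).comp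
    (tendsto_add_atTop_nat 1)
  exact tendsto_nhds_unique h1 hw

/-- Weighted sums of the iterates converge to a constant near a point of vanishing Green function
that is accumulated by escaping points only when all the weights are zero. -/
theorem eq_zero_of_eventually_tendsto {a : ℕ → ℂ} {z c : ℂ} (hz : greenFun f z = 0)
    (hpos : ∀ U ∈ 𝓝 z, ∃ x ∈ U, 0 < greenFun f x)
    (h : ∀ᶠ w in 𝓝 z, Tendsto (fun N => iterateSum f a N w) atTop (𝓝 c)) (n : ℕ) : a n = 0 := by
  obtain ⟨x, hx, hx0⟩ := hpos _ h
  have hxT := greenFun_mem_doubleExpRates hf hx0 hx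
  -- Bounded rates are refuted by overconvergence past their supremum; unbounded rates make the
  -- series entire, hence constant.
  by_cases hb : BddAbove (doubleExpRates f.natDegree a)
  · exfalso
    set e := sSup (doubleExpRates f.natDegree a)
    have he0 : 0 < e := hx0.trans_le (le_csSup hb hxT)
    have hT : ∀ t < e, t ∈ doubleExpRates f.natDegree a := fun t ht => by
      obtain ⟨s, hs, hts⟩ := exists_lt_of_lt_csSup ⟨_, hxT⟩ ht
      exact doubleExpRates_anti hts.le hs
    obtain ⟨y, hy⟩ := exists_le_greenFun hf hx0 e
    have hze : greenFun f z < e := by rwa [hz]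
    obtain ⟨p, hpe, hp, r, hr, L, hL, hLG, hLp⟩ :=
      exists_regular_boundary_point (continuous_greenFun hf)
        (fun p hp => exists_re_eq_greenFun hf (p := p) (by rwa [hp])) hze hy
    obtain ⟨ρ, hρ, hρV⟩ := exists_ball_sublevel_subset hr hL hLG hLp hp
    have hS := iterateSeries_eqOn_connectedComponentIn hf hT hze h
    obtain ⟨q, hq, hqV⟩ :=
      mem_closure_iff_nhds.1 hp _ (Metric.ball_mem_nhds p (lt_min hr hρ))
    have hqe : greenFun f q < e := connectedComponentIn_subset {w | greenFun f w < e} _ hqV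
    have hsr := Metric.ball_subset_ball (x := p) (min_le_left r ρ)
    have hsρ := Metric.ball_subset_ball (x := p) (min_le_right r ρ)
    obtain ⟨μ, hμ, M, hM, hbound⟩ := exists_norm_iterateSum_sub_le hf hT (hL.mono hsr)
      (fun w hw => hLG w (hsr hw)) hpe (fun w hw hwe => hS (hρV w (hsρ hw) hwe)) hq hqe
    obtain ⟨t, hpt, ht⟩ := exists_gt_mem_doubleExpRates hf (by rwa [hpe]) hμ hM hbound
    rw [hpe] at hpt
    exact absurd (le_csSup hb ht) (not_le.2 hpt)
  · have hT : ∀ t, t ∈ doubleExpRates f.natDegree a := fun t => by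
      obtain ⟨s, hs, hts⟩ := not_bddAbove_iff.1 hb t
      exact doubleExpRates_anti hts.le hs
    refine eq_zero_of_iterateSeries_const hf hT (c := c) (fun w => ?_) n
    have hopen : ∀ t, IsOpen {w | greenFun f w < t} := fun t =>
      isOpen_lt (continuous_greenFun hf) continuous_const
    have hd : Differentiable ℂ (iterateSeries f a) := fun w =>
      (differentiableOn_iterateSeries hf (hT (greenFun f w + 1))).differentiableAt
        ((hopen _).mem_nhds (show greenFun f w < greenFun f w + 1 from lt_add_one _))
    have hzV := iterateSeries_eqOn_connectedComponentIn hf (e := 1) (fun t _ => hT t)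
      (by rw [hz]; exact one_pos) h
    have hev : iterateSeries f a =ᶠ[𝓝 z] fun _ => c := by
      filter_upwards [((hopen 1).connectedComponentIn (x := z)).mem_nhds
        (mem_connectedComponentIn (by
          change greenFun f z < 1
          rw [hz]
          exact one_pos))] with w hw using hzV hw
    exact (hd.differentiableOn.analyticOnNhd isOpen_univ).eqOn_of_preconnected_of_eventuallyEq
      analyticOnNhd_const isPreconnected_univ (Set.mem_univ z) hev (Set.mem_univ w)

end TimeAverage

theorem mainTheorem8 (f : Polynomial ℂ) (hf : 2 ≤ f.natDegree) (z : ℂ)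
    (hz : z ∈ juliaSet (fun w => f.eval w)) :
    ¬ HasTimeAverageNear (fun w => f.eval w) z := by
  rintro ⟨U, hU, c, a, ⟨n, hn⟩, h⟩
  refine hn (eq_zero_of_eventually_tendsto hf (c := c) (greenFun_eq_zero_of_mem_juliaSet hf hz)
    (fun V hV => exists_greenFun_pos_of_mem_juliaSet hf hz hV) ?_ n)
  filter_upwards [hU] with w hw using h.tendsto_at hw
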